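/- An \emph{$m\times n$ $\lambda$-rectangle} is an $m\times n$ array in which each of the numbers $1,2,\dots,mn$ occurs exactly once and in which any two entries in the same row or in the same column differ by at least $2$. An \emph{$L(2,1)$-coloring} of a graph assigns integer labels to the vertices so that adjacent vertices get labels differing by at least $2$ and vertices at distance two get distinct labels. For a $p\times q$ table $t=(t_{ij})$ of non-negative integers, the \emph{skew graph} of $t$ has $t_{ij}$ vertices in box $(i,j)$, two vertices being adjacent iff their boxes lie in different rows and in different columns. A vertex $v$ of a finite graph $G$ is \emph{tough} if, for every $S\subseteq V(G)\setminus\{v\}$, the graph $(G\setminus v)\setminus S$ has at most $|S|+1$ connected components, and at most $|S|$ components whenever $S$ contains all neighbours of $v$. \emph{The algorithm.} Given a skew graph $G$ by its table, start at any tough vertex $v$ of $G$. At each stage delete the current vertex $v$ from the current graph, list all neighbours $w$ of $v$ that are tough in the remaining graph, and move to any one of them; the search branches over all choices. A run ends when all vertices have been visited or when the list of candidates is empty; the runs that have visited all vertices are the generated paths. Tough vertices are found from the table by means of row sums, column sums and counters derived from them. Writing $1,2,3,\dots$ into the successive boxes of a path turns a path on the table with one vertex in each box into an array. \textbf{Theorem.}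 (1) For all integers $m,n\ge 2$ with $(m,n)\ne(2,2)$ there is an $m\times n$ $\lambda$-rectangle. (2) An $m\times n$ array is a $\lambda$-rectangle if and only if it is an $L(2,1)$-coloring of $K_m\Box K_n$ with labels in $\{1,\dots,mn\}$. (3) For every table $t$, the test on row sums, column sums and counters used by the algorithm selects exactly the boxes whose vertices are tough in the skew graph of $t$. (4) For all $m,n\ge 1$, the arrays obtained from the paths that the algorithm generates on the $m\times n$ table with one vertex in each box are exactly the $m\times n$ $\lambda$-rectangles. (5) There is an absolute constant $C$ such that, for all $m,n\ge1$, each run of the algorithm on this table, including the computation of the complete list of candidates at every stage, takes at most $C\,(mn)^2$ elementary operations (that is, $O(pqN)$ with $p=m$ rows, $q=n$ columns and $N=mn$ vertices). -/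

import Mathlib

/-- An `m × n` `lambda`-rectangle: an array with the entries `1, 2, …, m * n`, each used exactly once,
in which two distinct entries in the same row or in the same column differ by at least two. -/
def IsLambdaRectangle {m n : ℕ} (A : Fin m → Fin n → ℕ) : Prop :=
  Set.BijOn (fun x : Fin m × Fin n => A x.1 x.2) Set.univ (Set.Icc 1 (m * n)) ∧
  (∀ i j j', j ≠ j' → 2 ≤ |(A i j : ℤ) - (A i j' : ℤ)|) ∧
  (∀ i i' j, i ≠ i' → 2 ≤ |(A i j : ℤ) - (A i' j : ℤ)|)

/-- `L(2,1)`-coloring of a graph: adjacent vertices receive labels which differ by at least two, and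
vertices at distance two receive distinct labels. -/
def IsL21Coloring {V : Type*} (G : SimpleGraph V) (f : V → ℕ) : Prop :=
  (∀ u v, G.Adj u v → 2 ≤ |(f u : ℤ) - (f v : ℤ)|) ∧ (∀ u v, G.dist u v = 2 → f u ≠ f v)

/-! ### Skew graphs and tough vertices -/

/-- The skew graph of a table of non-negative integers: the box in row `i` and column `j` holds
`t i j` vertices, and two vertices are adjacent when their boxes are in different rows and in
different columns. -/
def skewGraph {p q : ℕ} (t : Fin p → Fin q → ℕ) :
    SimpleGraph (Σ b : Fin p × Fin q, Fin (t b.1 b.2)) where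
  Adj u v := u.1.1 ≠ v.1.1 ∧ u.1.2 ≠ v.1.2
  symm := ⟨fun _ _ h => ⟨h.1.symm, h.2.symm⟩⟩
  loopless := ⟨fun _ h => h.1 rfl⟩

/-- The number of connected components of the graph obtained from `G` by deleting `S`. -/
noncomputable def componentsAfterDeleting {V : Type*} (G : SimpleGraph V) (S : Set V) : ℕ :=
  Nat.card (G.induce Sᶜ).ConnectedComponent

/-- Tough vertices of a finite graph: for every set `S` of vertices other than `v`, the graph
`(G ∖ v) ∖ S` has at most `|S| + 1` components, and at most `|S|` if `S` contains all the
neighbours of `v`. -/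
def IsToughVertex {V : Type*} (G : SimpleGraph V) (v : V) : Prop :=
  ∀ S : Set V, v ∉ S →
    componentsAfterDeleting G (insert v S) ≤ S.ncard + 1 ∧
    (G.neighborSet v ⊆ S → componentsAfterDeleting G (insert v S) ≤ S.ncard)

/-! ### Step counting

A `Timed` value is the result of a computation together with the number of elementary operations
(reading or writing a cell of an array, adding, subtracting, comparing or combining truth values,
appending to a list) on a unit-cost random access machine. -/

/-- A result together with the number of steps spent on it. -/
structure Timed (α : Type) where
  val : α
  steps : ℕ

instance : Monad Timed where
  pure x := ⟨x, 0⟩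
  bind x f := ⟨(f x.val).val, x.steps + (f x.val).steps⟩

/-- An expression which is evaluated with at most `k` elementary operations. -/
def charge {α : Type} (k : ℕ) (x : α) : Timed α := ⟨x, k⟩

/-- `for i < n do s := s + f i`, starting from `s := 0`; each round costs two more steps for the
counter and the addition. -/
def sumLoop {n : ℕ} (f : Fin n → Timed ℕ) : Timed ℕ :=
  ⟨∑ i, (f i).val, 1 + ∑ i, ((f i).steps + 2)⟩

/-- `for i < n do a[i] := f i`; the result is an array. -/
def arrayLoop {n : ℕ} (f : Fin n → Timed ℕ) : Timed (Fin n → ℕ) :=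
  ⟨fun i => (f i).val, 1 + ∑ i, ((f i).steps + 2)⟩

/-- `for i < p do for j < q do if test i j then append (i, j)`; the result is a list of boxes. -/
def selectLoop {p q : ℕ} (test : Fin p → Fin q → Timed Bool) : Timed (List (Fin p × Fin q)) :=
  ⟨(List.finRange p ×ˢ List.finRange q).filter (fun b => (test b.1 b.2).val),
    1 + ∑ i, (2 + ∑ j, ((test i j).steps + 3))⟩

/-- `1` if the condition holds and `0` otherwise. -/
def ind (P : Prop) [Decidable P] : ℕ := if P then 1 else 0

/-! ### The generation algorithm

In what follows `t` is the table of the current graph, `N` its number of vertices, `r i` and `c j`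
the numbers of vertices in row `i` and in column `j`. Deleting one vertex `w` must leave a graph in
which no row, no column and no pair (row, column), neither of which contains the other, is too large.
For a pair (row, column) the four conditions below say that the pair is too large once a vertex `w`
is deleted that lies, respectively, outside both, in the row only, in the column only, in both. -/

/-- Row and column of sizes `r`, `c`, meeting in `x` vertices; `w` lies in neither of them. -/
def heavyOutside (x r c N : ℕ) : ℕ := ind (x < r ∧ x < c ∧ N < r + c + 1)

/-- Row and column of sizes `r`, `c`, meeting in `x` vertices; `w` lies only in the row. -/
def heavyInRow (x r c N : ℕ) : ℕ := ind (x + 1 < r ∧ x < c ∧ N < r + c)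

/-- Row and column of sizes `r`, `c`, meeting in `x` vertices; `w` lies only in the column. -/
def heavyInColumn (x r c N : ℕ) : ℕ := ind (x < r ∧ x + 1 < c ∧ N < r + c)

/-- Row and column of sizes `r`, `c`, meeting in `x` vertices; `w` lies in both of them. -/
def heavyInBoth (x r c N : ℕ) : ℕ := ind (x < r ∧ x < c ∧ N < r + c)

/-- The list of the boxes whose vertices are tough in the skew graph of `t`, computed from row sums,
column sums and a few counters. The last condition of the test rejects `w` if deleting it leaves
exactly four non-empty boxes, the intersections of two rows and two columns. -/
def toughBoxes {p q : ℕ} (t : Fin p → Fin q → ℕ) : Timed (List (Fin p × Fin q)) := do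
  let r ← arrayLoop fun i => sumLoop fun j => charge 1 (t i j)
  let c ← arrayLoop fun j => sumLoop fun i => charge 1 (t i j)
  let N ← sumLoop fun i => charge 1 (r i)
  let bigRows ← sumLoop fun i => charge 3 (ind (N < 2 * r i))
  let bigCols ← sumLoop fun j => charge 3 (ind (N < 2 * c j))
  let usedRows ← sumLoop fun i => charge 2 (ind (0 < r i))
  let usedCols ← sumLoop fun j => charge 2 (ind (0 < c j))
  let usedBoxes ← sumLoop fun i => sumLoop fun j => charge 2 (ind (0 < t i j))
  let outRow ← arrayLoop fun i => sumLoop fun j => charge 12 (heavyOutside (t i j) (r i) (c j) N)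
  let outCol ← arrayLoop fun j => sumLoop fun i => charge 12 (heavyOutside (t i j) (r i) (c j) N)
  let out ← sumLoop fun i => charge 1 (outRow i)
  let inRow ← arrayLoop fun i => sumLoop fun j => charge 12 (heavyInRow (t i j) (r i) (c j) N)
  let inCol ← arrayLoop fun j => sumLoop fun i => charge 12 (heavyInColumn (t i j) (r i) (c j) N)
  selectLoop fun i j => charge 120 (decide (
    0 < t i j ∧
    bigRows = ind (N < 2 * r i) ∧ 2 * r i ≤ N + 1 ∧
    bigCols = ind (N < 2 * c j) ∧ 2 * c j ≤ N + 1 ∧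
    out + heavyOutside (t i j) (r i) (c j) N = outRow i + outCol j ∧
    inRow i = heavyInRow (t i j) (r i) (c j) N ∧
    inCol j = heavyInColumn (t i j) (r i) (c j) N ∧
    heavyInBoth (t i j) (r i) (c j) N = 0 ∧
    ¬ (usedRows = 2 + ind (r i = 1) ∧ usedCols = 2 + ind (c j = 1) ∧
       usedBoxes = 4 + ind (t i j = 1))))

/-- Delete one vertex in box `v`: one cell of the table is overwritten (and restored later, when the
search comes back to this point). -/
def deleteVertex {p q : ℕ} (t : Fin p → Fin q → ℕ) (v : Fin p × Fin q) :
    Timed (Fin p → Fin q → ℕ) :=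
  charge 6 (fun i j => if (i, j) = v then t i j - 1 else t i j)

/-- One stage of the algorithm at the vertex `v` of the current graph: delete `v`, and list the
neighbours of `v` that are tough in the remaining graph. -/
def stage {p q : ℕ} (t : Fin p → Fin q → ℕ) (v : Fin p × Fin q) :
    Timed ((Fin p → Fin q → ℕ) × List (Fin p × Fin q)) := do
  let t' ← deleteVertex t v
  let L ← toughBoxes t'
  let L' ← charge (1 + 6 * L.length) (L.filter fun w => decide (w.1 ≠ v.1 ∧ w.2 ≠ v.2))
  return (t', L')

/-- All runs of the algorithm which start from a vertex `v`, where `k` is the number of vertices other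
than `v` in the current graph `t`. At each stage the run branches over all candidates for the next
vertex; a run ends when all vertices are visited or when there is no candidate. A run is recorded as
the list of the visited boxes together with the number of steps spent along the run, where each stage
is charged with the computation of the whole list of candidates. -/
def runsFrom {p q : ℕ} :
    ℕ → (Fin p → Fin q → ℕ) → (Fin p × Fin q) → List (List (Fin p × Fin q) × ℕ)
  | 0, _, v => [([v], 3)]
  | k + 1, t, v =>
    if (stage t v).val.2 = [] then [([v], (stage t v).steps + 3)]
    else (stage t v).val.2.flatMap fun w =>
      (runsFrom k (stage t v).val.1 w).map fun ρ => (v :: ρ.1, (stage t v).steps + 3 + ρ.2)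

/-- All runs of the algorithm, from all tough vertices of the skew graph of `t`. -/
def runs {p q : ℕ} (t : Fin p → Fin q → ℕ) : List (List (Fin p × Fin q) × ℕ) :=
  let N := sumLoop fun i => sumLoop fun j => charge 1 (t i j)
  (toughBoxes t).val.flatMap fun v =>
    (runsFrom (N.val - 1) t v).map fun ρ => (ρ.1, N.steps + (toughBoxes t).steps + 3 + ρ.2)

/-- The table of the complement of the Cartesian product of complete graphs on `m` and `n` vertices:
one vertex in each box. -/
def onesTable (m n : ℕ) : Fin m → Fin n → ℕ := fun _ _ => 1

/-- The paths which the algorithm returns on the table with one vertex in each box: the runs which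
have visited all the vertices. -/
def generatedPaths (m n : ℕ) : List (List (Fin m × Fin n)) :=
  ((runs (onesTable m n)).filter fun ρ => decide (ρ.1.length = m * n)).map Prod.fst

/-- The array obtained from a path by writing `1, 2, 3, …` into the successive boxes of the path. -/
def arrayOfPath {m n : ℕ} (P : List (Fin m × Fin n)) : Fin m → Fin n → ℕ :=
  fun i j => P.idxOf (i, j) + 1

/-! Toughness. Passing from the deleted set `S` to the kept set `X`, a vertex `v` is tough iff
c(G[X]) + |X| ≤ |V| for every `X` avoiding `v`, with one to spare when `X` has no neighbour of `v`;
here c counts components (`isToughVertex_iff`). In a skew graph few shapes of `X` matter. A set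
inside one row or one column is independent. A set covered by a row and a column, but by neither
alone, consists of isolated crossing vertices and one further component
(`card_components_le_of_cross`). Any other set is connected, unless it fills a 2 × 2 grid of boxes,
whose two diagonals are then its components (`card_components_le_one_or_isGrid`). So toughness
reduces to inequalities between the sizes of rows, columns and crosses, together with one
exceptional grid (`isToughVertex_iff_isBalanced`), and the counters evaluate exactly these
(`mem_toughBoxes_iff_isBalanced`).

Generation. Consecutive numbers of a rectangle must lie in different rows and columns, so rectangles
are Hamiltonian paths of the skew graph with one vertex in each box. The first vertex of a
Hamiltonian path is tough (`isToughVertex_of_positions`), and a tail of the path is a Hamiltonian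
path of what remains; hence pruning to tough candidates never loses a path (`mem_runsFrom_of_path`).
Conversely, every run is a skew path without surplus visits.

Existence comes from an explicit walk along diagonals (`diagonalBox`). For the running time, a stage
costs O(mn) and a run has at most mn stages. -/

/-! ### Components of induced subgraphs -/

section Components

variable {V γ : Type*} (G : SimpleGraph V)

/-- A function which is constant along the edges of `G[X]` takes at most as many values on `X` as
`G[X]` has components. -/
theorem ncard_image_le_card_components [Finite V] (X : Set V) (f : V → γ)
    (hf : ∀ u ∈ X, ∀ w ∈ X, G.Adj u w → f u = f w) :
    (f '' X).ncard ≤ Nat.card (G.induce X).ConnectedComponent := by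
  have key : ∀ u w : X, (G.induce X).Reachable u w → f u = f w := by
    rintro u w ⟨p⟩
    induction p with
    | nil => rfl
    | cons h _ ih => exact (hf _ (Subtype.prop _) _ (Subtype.prop _) h).trans ih
  let g : (G.induce X).ConnectedComponent → γ :=
    SimpleGraph.ConnectedComponent.lift (fun u : X => f u) (fun u w p _ => key u w ⟨p⟩)
  have hsub : f '' X ⊆ g '' Set.univ := by
    rintro _ ⟨u, hu, rfl⟩
    exact ⟨(G.induce X).connectedComponentMk ⟨u, hu⟩, trivial, rfl⟩
  calc (f '' X).ncard ≤ (g '' Set.univ).ncard := Set.ncard_le_ncard hsub (Set.toFinite _)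
    _ ≤ (Set.univ : Set (G.induce X).ConnectedComponent).ncard := Set.ncard_image_le (Set.toFinite _)
    _ = _ := Set.ncard_univ _

/-- A set which meets every component of `G[X]` has at least as many elements as there are
components. -/
theorem card_components_le_ncard [Finite V] (X T : Set V)
    (h : ∀ u : X, ∃ w : X, w.1 ∈ T ∧ (G.induce X).Reachable u w) :
    Nat.card (G.induce X).ConnectedComponent ≤ T.ncard := by
  have h' : ∀ c : (G.induce X).ConnectedComponent,
      ∃ w : X, w.1 ∈ T ∧ (G.induce X).connectedComponentMk w = c := by
    intro c
    induction c using SimpleGraph.ConnectedComponent.ind with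
    | h u =>
      obtain ⟨w, hw, hr⟩ := h u
      exact ⟨w, hw, (SimpleGraph.ConnectedComponent.eq.2 hr).symm⟩
  choose f hf hc using h'
  have hinj : Function.Injective fun c => (⟨(f c).1, hf c⟩ : T) := by
    intro c d hcd
    have : (f c).1 = (f d).1 := congrArg (fun w : T => w.1) hcd
    rw [← hc c, ← hc d, Subtype.ext this]
  exact (Nat.card_le_card_of_injective _ hinj).trans_eq (Nat.card_coe_set_eq T)

theorem card_components_le_ncard_self [Finite V] (X : Set V) :
    Nat.card (G.induce X).ConnectedComponent ≤ X.ncard :=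
  card_components_le_ncard G X X fun u => ⟨u, u.2, .rfl⟩

/-- Toughness of a vertex in terms of the sets of vertices which are kept. -/
theorem isToughVertex_iff [Finite V] (v : V) :
    IsToughVertex G v ↔ ∀ X : Set V, v ∉ X →
      Nat.card (G.induce X).ConnectedComponent + X.ncard ≤ Nat.card V ∧
      ((∀ u ∈ X, ¬ G.Adj v u) →
        Nat.card (G.induce X).ConnectedComponent + X.ncard + 1 ≤ Nat.card V) := by
  have hcard : ∀ S : Set V, v ∉ S → S.ncard + 1 + (insert v S)ᶜ.ncard = Nat.card V := by
    intro S hS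
    rw [← Set.ncard_insert_of_notMem hS, Set.ncard_add_ncard_compl]
  constructor
  · intro h X hX
    have hS : v ∉ (insert v X)ᶜ := by simp
    have hXc : (insert v (insert v X)ᶜ)ᶜ = X := by
      ext u
      by_cases hu : u = v
      · subst hu; simp [hX]
      · simp [hu]
    have hc := hcard _ hS
    have h1 := h _ hS
    unfold componentsAfterDeleting at h1
    rw [hXc] at h1 hc
    refine ⟨by omega, fun hn => ?_⟩
    have := h1.2 (fun u hu => by
      simp only [Set.mem_compl_iff, Set.mem_insert_iff, not_or]
      exact ⟨fun e => G.loopless.irrefl v (e ▸ hu), fun hx => hn u hx hu⟩)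
    omega
  · intro h S hS
    have hc := hcard S hS
    have h1 := h (insert v S)ᶜ (by simp)
    unfold componentsAfterDeleting
    refine ⟨by omega, fun hn => ?_⟩
    have := h1.2 (fun u hu ha => hu (Or.inr (hn ha)))
    omega

/-- The first vertex of a Hamiltonian path is tough. The path is given by the positions of the
vertices. -/
theorem isToughVertex_of_positions [Finite V] (v : V) (idx : V → ℕ) (hinj : Function.Injective idx)
    (h : ∀ u, u ≠ v → ∃ w, G.Adj w u ∧ idx w + 1 = idx u) : IsToughVertex G v := by
  rw [isToughVertex_iff]
  intro X hX
  have hmin : ∀ c : (G.induce X).ConnectedComponent, ∃ u : X,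
      (G.induce X).connectedComponentMk u = c ∧
      ∀ w : X, (G.induce X).connectedComponentMk w = c → idx u ≤ idx w := by
    intro c
    obtain ⟨u, hu, hle⟩ := Set.exists_min_image {u : X | (G.induce X).connectedComponentMk u = c}
      (fun u => idx u) (Set.toFinite _) c.exists_rep
    exact ⟨u, hu, hle⟩
  choose f hf hfmin using hmin
  -- A predecessor inside `X` would lie in the same component at a smaller position, against the
  -- minimality of `f c`. Distinct components thus have distinct predecessors outside `X`.
  have hpred : ∀ c, ∃ w, w ∉ X ∧ G.Adj w (f c) ∧ idx w + 1 = idx (f c) := by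
    intro c
    obtain ⟨w, hw, hi⟩ := h (f c) (fun e => hX (e ▸ (f c).2))
    refine ⟨w, fun hwX => ?_, hw, hi⟩
    have hadj : (G.induce X).Adj ⟨w, hwX⟩ (f c) := hw
    have := hfmin c ⟨w, hwX⟩ ((SimpleGraph.ConnectedComponent.eq.2 hadj.reachable).trans (hf c))
    simp only at this
    omega
  choose g hgX hadj hg using hpred
  have hginj : Function.Injective g := by
    intro c d hcd
    have : idx (f c) = idx (f d) := by rw [← hg, ← hg, hcd]
    rw [← hf c, ← hf d, Subtype.ext (hinj this)]
  have hbound : ∀ T : Set V, (∀ c, g c ∈ T) →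
      Nat.card (G.induce X).ConnectedComponent ≤ T.ncard := by
    intro T hT
    have : Function.Injective fun c => (⟨g c, hT c⟩ : T) :=
      fun c d hcd => hginj (congrArg Subtype.val hcd)
    exact (Nat.card_le_card_of_injective _ this).trans_eq (Nat.card_coe_set_eq T)
  have hcompl := Set.ncard_add_ncard_compl X
  refine ⟨by have := hbound Xᶜ hgX; omega, fun hn => ?_⟩
  -- If `X` has no neighbour of `v`, then `v` is not a predecessor either, which gains one.
  have h1 := hbound (Xᶜ \ {v}) (fun c => ⟨hgX c, fun e => hn _ (f c).2 (by
    rw [← Set.mem_singleton_iff.1 e]; exact hadj c)⟩)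
  have h2 := Set.ncard_sdiff_singleton_add_one (a := v) (s := Xᶜ) hX
  omega

end Components

/-! ### Components of skew graphs -/

section Skew

variable {V α β : Type*} {G : SimpleGraph V} {ρ : V → α} {κ : V → β}

/-- A set of vertices in the union of a row and a column, in neither of which it is contained. -/
theorem card_components_le_of_cross [Finite V] (hG : ∀ u w, G.Adj u w ↔ ρ u ≠ ρ w ∧ κ u ≠ κ w)
    {X : Set V} {i : α} {j : β} (hX : ∀ u ∈ X, ρ u = i ∨ κ u = j)
    {a b : V} (ha : a ∈ X) (haj : κ a ≠ j) (hb : b ∈ X) (hbi : ρ b ≠ i) :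
    Nat.card (G.induce X).ConnectedComponent ≤ {u ∈ X | ρ u = i ∧ κ u = j}.ncard + 1 := by
  have hai : ρ a = i := (hX a ha).resolve_right haj
  have hbj : κ b = j := (hX b hb).resolve_left hbi
  refine (card_components_le_ncard G X (insert a {u ∈ X | ρ u = i ∧ κ u = j}) ?_).trans
    (Set.ncard_insert_le _ _)
  -- Off the crossing, the row part is joined to `b` and the column part to `a`, so `a` represents
  -- both; each crossing vertex represents itself.
  have hab : (G.induce X).Adj ⟨a, ha⟩ ⟨b, hb⟩ := by
    rw [SimpleGraph.induce_adj, hG]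
    exact ⟨hai ▸ hbi.symm, hbj ▸ haj⟩
  rintro ⟨u, hu⟩
  by_cases hi : ρ u = i
  · by_cases hj : κ u = j
    · exact ⟨⟨u, hu⟩, Or.inr ⟨hu, hi, hj⟩, .rfl⟩
    · have hub : (G.induce X).Adj ⟨u, hu⟩ ⟨b, hb⟩ := by
        rw [SimpleGraph.induce_adj, hG]
        exact ⟨hi ▸ hbi.symm, hbj ▸ hj⟩
      exact ⟨⟨a, ha⟩, Or.inl rfl, hub.reachable.trans hab.symm.reachable⟩
  · have hj := (hX u hu).resolve_left hi
    have hua : (G.induce X).Adj ⟨u, hu⟩ ⟨a, ha⟩ := by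
      rw [SimpleGraph.induce_adj, hG]
      exact ⟨hai ▸ hi, hj ▸ haj.symm⟩
    exact ⟨⟨a, ha⟩, Or.inl rfl, hua.reachable⟩

/-- The four intersections of two rows and two columns are non-empty and cover `X`. -/
def IsGrid (ρ : V → α) (κ : V → β) (X : Set V) : Prop :=
  ∃ i i' j j', i ≠ i' ∧ j ≠ j' ∧ (∃ u ∈ X, ρ u = i ∧ κ u = j) ∧ (∃ u ∈ X, ρ u = i ∧ κ u = j') ∧
    (∃ u ∈ X, ρ u = i' ∧ κ u = j) ∧ (∃ u ∈ X, ρ u = i' ∧ κ u = j') ∧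
    ∀ u ∈ X, (ρ u = i ∨ ρ u = i') ∧ (κ u = j ∨ κ u = j')

theorem IsGrid.swap {X : Set V} (h : IsGrid κ ρ X) : IsGrid ρ κ X := by
  obtain ⟨j, j', i, i', hj, hi, ⟨a, ha, ha1, ha2⟩, ⟨b, hb, hb1, hb2⟩, ⟨c, hc, hc1, hc2⟩,
    ⟨d, hd, hd1, hd2⟩, h⟩ := h
  exact ⟨i, i', j, j', hi, hj, ⟨a, ha, ha2, ha1⟩, ⟨c, hc, hc2, hc1⟩, ⟨b, hb, hb2, hb1⟩,
    ⟨d, hd, hd2, hd1⟩, fun u hu => (h u hu).symm⟩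

/-- An edge of a 2 × 2 grid changes both the row and the column, so it never leaves its diagonal. -/
theorem IsGrid.two_le_card_components [Finite V]
    (hG : ∀ u w, G.Adj u w ↔ ρ u ≠ ρ w ∧ κ u ≠ κ w) {X : Set V} (h : IsGrid ρ κ X) :
    2 ≤ Nat.card (G.induce X).ConnectedComponent := by
  obtain ⟨i, i', j, j', hi, hj, ⟨a, ha, ha1, ha2⟩, ⟨b, hb, hb1, hb2⟩, -, -, h⟩ := h
  refine le_trans ?_ (ncard_image_le_card_components G X (fun u => (ρ u = i ↔ κ u = j)) ?_)
  · have : ({True, False} : Set Prop) ⊆ (fun u => (ρ u = i ↔ κ u = j)) '' X := by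
      rintro _ (rfl | rfl)
      · exact ⟨a, ha, by simp [ha1, ha2]⟩
      · exact ⟨b, hb, by simp [hb1, hb2, hj.symm]⟩
    exact (Set.ncard_pair (by simp)).symm.le.trans (Set.ncard_le_ncard this (Set.toFinite _))
  · intro u hu w hw hadj
    have := (hG u w).1 hadj
    have h1 := h u hu
    have h2 := h w hw
    simp only [eq_iff_iff]
    grind

/-- Suppose `u` and `w` are not connected. A vertex in another row is adjacent to one of them, and
to both unless it lies in the column of `u` or of `w`. Since `X` is not covered by a row and a
column, this yields `a` below `w` and `b` below `u`; they must share a row, as otherwise the path u,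
a, b, w exists. Any vertex outside these four boxes would connect the two diagonals. -/
theorem reachable_or_isGrid_of_row_eq (hG : ∀ u w, G.Adj u w ↔ ρ u ≠ ρ w ∧ κ u ≠ κ w)
    {X : Set V} (hX : ∀ i j, ∃ u ∈ X, ρ u ≠ i ∧ κ u ≠ j) (u w : X) (huw : ρ u = ρ w) :
    (G.induce X).Reachable u w ∨ IsGrid ρ κ X := by
  by_contra! hcon
  obtain ⟨hr, hg⟩ := hcon
  have step : ∀ (a b : X), ρ a ≠ ρ b → κ a ≠ κ b → (G.induce X).Reachable a b := fun a b h1 h2 =>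
    SimpleGraph.Adj.reachable (by rw [SimpleGraph.induce_adj, hG]; exact ⟨h1, h2⟩)
  obtain ⟨a, ha, ha1, ha2⟩ := hX (ρ u) (κ u)
  obtain ⟨b, hb, hb1, hb2⟩ := hX (ρ u) (κ w)
  have hua := step u ⟨a, ha⟩ ha1.symm ha2.symm
  have hwb := step w ⟨b, hb⟩ (huw ▸ hb1.symm) hb2.symm
  have hcols : ∀ z : X, ρ z ≠ ρ u → κ z = κ u ∨ κ z = κ w := by
    intro z hz
    by_contra! hc
    exact hr ((step u z hz.symm hc.1.symm).trans (step z w (huw ▸ hz) hc.2))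
  have hne : κ u ≠ κ w := fun e => hr (hua.trans (step ⟨a, ha⟩ w (huw ▸ ha1) (e ▸ ha2)))
  have haw : κ a = κ w := (hcols ⟨a, ha⟩ ha1).resolve_left ha2
  have hbu : κ b = κ u := (hcols ⟨b, hb⟩ hb1).resolve_right hb2
  have hab : ¬ (G.induce X).Reachable ⟨a, ha⟩ ⟨b, hb⟩ :=
    fun h => hr (hua.trans (h.trans hwb.symm))
  have habr : ρ a = ρ b := by
    by_contra h
    exact hab (step _ _ h (by simp only [haw, hbu]; exact hne.symm))
  refine hg ⟨ρ u, ρ a, κ u, κ w, ha1.symm, hne, ⟨u, u.2, rfl, rfl⟩, ⟨w, w.2, huw.symm, rfl⟩,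
    ⟨b, hb, habr.symm, hbu⟩, ⟨a, ha, rfl, haw⟩, fun z hz => ?_⟩
  by_cases hzu : ρ z = ρ u
  · refine ⟨Or.inl hzu, ?_⟩
    by_contra! hc
    exact hab ((step ⟨a, ha⟩ ⟨z, hz⟩ (hzu ▸ ha1) (by simp only [haw]; exact hc.2.symm)).trans
      (step ⟨z, hz⟩ ⟨b, hb⟩ (hzu ▸ hb1.symm) (by simp only [hbu]; exact hc.1)))
  · refine ⟨Or.inr ?_, hcols ⟨z, hz⟩ hzu⟩
    by_contra hza
    rcases hcols ⟨z, hz⟩ hzu with h | h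
    · have h1 := step ⟨a, ha⟩ ⟨z, hz⟩ (Ne.symm hza) (by simp only [haw, h]; exact hne.symm)
      exact hr (hua.trans (h1.trans (step ⟨z, hz⟩ w (huw ▸ hzu) (by simp only [h]; exact hne))))
    · have h1 := step ⟨z, hz⟩ ⟨b, hb⟩ (habr ▸ hza) (by simp only [hbu, h]; exact hne.symm)
      exact hr ((step u ⟨z, hz⟩ (Ne.symm hzu) (by simp only [h]; exact hne)).trans
        (h1.trans hwb.symm))

/-- A set of vertices which is not contained in the union of a row and a column. -/
theorem card_components_le_one_or_isGrid [Finite V]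
    (hG : ∀ u w, G.Adj u w ↔ ρ u ≠ ρ w ∧ κ u ≠ κ w) {X : Set V}
    (hX : ∀ i j, ∃ u ∈ X, ρ u ≠ i ∧ κ u ≠ j) :
    Nat.card (G.induce X).ConnectedComponent ≤ 1 ∨ IsGrid ρ κ X := by
  by_cases hg : IsGrid ρ κ X
  · exact Or.inr hg
  refine Or.inl ?_
  have : ∀ u w : X, (G.induce X).Reachable u w := by
    intro u w
    by_cases h1 : ρ u = ρ w
    · exact (reachable_or_isGrid_of_row_eq hG hX u w h1).resolve_right hg
    by_cases h2 : κ u = κ w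
    · exact (reachable_or_isGrid_of_row_eq (ρ := κ) (κ := ρ)
        (fun u w => (hG u w).trans and_comm)
        (fun j i => (hX i j).imp fun u h => ⟨h.1, h.2.symm⟩) u w h2).resolve_right
          fun h => hg h.swap
    · exact SimpleGraph.Adj.reachable (by rw [SimpleGraph.induce_adj, hG]; exact ⟨h1, h2⟩)
  -- `hX` is vacuous if there are no rows or no columns, so `X` may be empty here.
  rcases X.eq_empty_or_nonempty with rfl | ⟨u, hu⟩
  · exact (card_components_le_ncard_self G ∅).trans (by simp)
  · exact (card_components_le_ncard G X {u} fun w => ⟨⟨u, hu⟩, rfl, this _ _⟩).trans (by simp)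

/-- Each diagonal is connected, since its two boxes are completely joined; `a` and `b` represent the
two diagonals. -/
theorem IsGrid.card_components_le_two [Finite V]
    (hG : ∀ u w, G.Adj u w ↔ ρ u ≠ ρ w ∧ κ u ≠ κ w) {X : Set V} (h : IsGrid ρ κ X) :
    Nat.card (G.induce X).ConnectedComponent ≤ 2 := by
  obtain ⟨i, i', j, j', hi, hj, ⟨a, ha, ha1, ha2⟩, ⟨b, hb, hb1, hb2⟩, ⟨c, hc, hc1, hc2⟩,
    ⟨d, hd, hd1, hd2⟩, h⟩ := h
  refine (card_components_le_ncard G X {a, b} ?_).trans ((Set.ncard_insert_le _ _).trans (by simp))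
  have step : ∀ (u w : X), ρ u ≠ ρ w → κ u ≠ κ w → (G.induce X).Reachable u w := fun u w h1 h2 =>
    SimpleGraph.Adj.reachable (by rw [SimpleGraph.induce_adj, hG]; exact ⟨h1, h2⟩)
  have had := step ⟨d, hd⟩ ⟨a, ha⟩ (by simp only; grind) (by simp only; grind)
  have hbc := step ⟨c, hc⟩ ⟨b, hb⟩ (by simp only; grind) (by simp only; grind)
  rintro ⟨u, hu⟩
  rcases h u hu with ⟨h1 | h1, h2 | h2⟩
  · exact ⟨⟨a, ha⟩, by simp, (step ⟨u, hu⟩ ⟨d, hd⟩ (by simp only; grind) (by simp only; grind)).trans had⟩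
  · exact ⟨⟨b, hb⟩, by simp, (step ⟨u, hu⟩ ⟨c, hc⟩ (by simp only; grind) (by simp only; grind)).trans hbc⟩
  · exact ⟨⟨b, hb⟩, by simp, step ⟨u, hu⟩ ⟨b, hb⟩ (by simp only; grind) (by simp only; grind)⟩
  · exact ⟨⟨a, ha⟩, by simp, step ⟨u, hu⟩ ⟨a, ha⟩ (by simp only; grind) (by simp only; grind)⟩

end Skew

/-! ### A numerical criterion for toughness in skew graphs -/

section Balanced

variable {V α β : Type*} {G : SimpleGraph V} {ρ : V → α} {κ : V → β}

/-- Deleting `v` leaves a graph in which no row, no column and no pair of a row and a column, neither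
of which contains the other, is too large, and which is not a grid of four boxes. -/
structure IsBalanced (ρ : V → α) (κ : V → β) (v : V) : Prop where
  row : ∀ i, 2 * {u | u ≠ v ∧ ρ u = i}.ncard ≤ Nat.card V
  row_self : 2 * {u | u ≠ v ∧ ρ u = ρ v}.ncard + 1 ≤ Nat.card V
  col : ∀ j, 2 * {u | u ≠ v ∧ κ u = j}.ncard ≤ Nat.card V
  col_self : 2 * {u | u ≠ v ∧ κ u = κ v}.ncard + 1 ≤ Nat.card V
  cross : ∀ i j, {u | u ≠ v ∧ ρ u = i ∧ κ u = j}.ncard < {u | u ≠ v ∧ ρ u = i}.ncard →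
    {u | u ≠ v ∧ ρ u = i ∧ κ u = j}.ncard < {u | u ≠ v ∧ κ u = j}.ncard →
    {u | u ≠ v ∧ ρ u = i}.ncard + {u | u ≠ v ∧ κ u = j}.ncard + 1 ≤ Nat.card V
  cross_self :
    {u | u ≠ v ∧ ρ u = ρ v ∧ κ u = κ v}.ncard < {u | u ≠ v ∧ ρ u = ρ v}.ncard →
    {u | u ≠ v ∧ ρ u = ρ v ∧ κ u = κ v}.ncard < {u | u ≠ v ∧ κ u = κ v}.ncard →
    {u | u ≠ v ∧ ρ u = ρ v}.ncard + {u | u ≠ v ∧ κ u = κ v}.ncard + 2 ≤ Nat.card V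
  grid : ¬ IsGrid ρ κ {u | u ≠ v}

theorem ncard_cross [Finite V] (v : V) (i : α) (j : β) :
    {u | u ≠ v ∧ (ρ u = i ∨ κ u = j)}.ncard + {u | u ≠ v ∧ ρ u = i ∧ κ u = j}.ncard =
      {u | u ≠ v ∧ ρ u = i}.ncard + {u | u ≠ v ∧ κ u = j}.ncard := by
  rw [← Set.ncard_union_add_ncard_inter {u | u ≠ v ∧ ρ u = i} {u | u ≠ v ∧ κ u = j}]
  congr 2 <;> ext u <;> simp only [Set.mem_union, Set.mem_inter_iff, Set.mem_ofPred_eq] <;> tauto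

/-- The sizes of a subset `X` of the union of a row and a column. -/
theorem ncard_add_ncard_le_of_cross [Finite V] {v : V} {X : Set V} (hv : v ∉ X) {i : α} {j : β}
    (hX : ∀ u ∈ X, ρ u = i ∨ κ u = j) :
    X.ncard + {u ∈ X | ρ u = i ∧ κ u = j}.ncard ≤
      {u | u ≠ v ∧ ρ u = i}.ncard + {u | u ≠ v ∧ κ u = j}.ncard := by
  rw [← ncard_cross v i j]
  refine add_le_add (Set.ncard_le_ncard ?_ (Set.toFinite _))
    (Set.ncard_le_ncard ?_ (Set.toFinite _))
  · exact fun u hu => ⟨fun e => hv (e ▸ hu), hX u hu⟩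
  · exact fun u hu => ⟨fun e => hv (e ▸ hu.1), hu.2⟩

theorem ncard_lt_of_mem [Finite V] {v a : V} {P Q : V → Prop} (hav : a ≠ v) (hP : P a)
    (hQ : ¬ Q a) (h : ∀ u, Q u → P u) : {u | u ≠ v ∧ Q u}.ncard < {u | u ≠ v ∧ P u}.ncard :=
  Set.ncard_lt_ncard ⟨fun u hu => ⟨hu.1, h u hu.2⟩, fun hs => hQ (hs ⟨hav, hP⟩).2⟩ (Set.toFinite _)

theorem IsBalanced.isToughVertex [Finite V] (hG : ∀ u w, G.Adj u w ↔ ρ u ≠ ρ w ∧ κ u ≠ κ w)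
    {v : V} (h : IsBalanced ρ κ v) : IsToughVertex G v := by
  rw [isToughVertex_iff]
  intro X hv
  have hself := card_components_le_ncard_self G X
  have hne : ∀ u ∈ X, u ≠ v := fun u hu e => hv (e ▸ hu)
  have hrow : ∀ i, (∀ u ∈ X, ρ u = i) → X.ncard ≤ {u | u ≠ v ∧ ρ u = i}.ncard := fun i hi =>
    Set.ncard_le_ncard (fun u hu => ⟨hne u hu, hi u hu⟩) (Set.toFinite _)
  have hcol : ∀ j, (∀ u ∈ X, κ u = j) → X.ncard ≤ {u | u ≠ v ∧ κ u = j}.ncard := fun j hj =>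
    Set.ncard_le_ncard (fun u hu => ⟨hne u hu, hj u hu⟩) (Set.toFinite _)
  have hcross : ∀ i j, (∀ u ∈ X, ρ u = i ∨ κ u = j) → (∀ u ∈ X, ρ u = i) ∨ (∀ u ∈ X, κ u = j) ∨
      (Nat.card (G.induce X).ConnectedComponent + X.ncard ≤
        {u | u ≠ v ∧ ρ u = i}.ncard + {u | u ≠ v ∧ κ u = j}.ncard + 1 ∧
      {u | u ≠ v ∧ ρ u = i ∧ κ u = j}.ncard < {u | u ≠ v ∧ ρ u = i}.ncard ∧
      {u | u ≠ v ∧ ρ u = i ∧ κ u = j}.ncard < {u | u ≠ v ∧ κ u = j}.ncard) := by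
    intro i j hX
    by_cases hb : ∀ u ∈ X, ρ u = i
    · exact Or.inl hb
    by_cases ha : ∀ u ∈ X, κ u = j
    · exact Or.inr (Or.inl ha)
    push Not at ha hb
    obtain ⟨a, ha, haj⟩ := ha
    obtain ⟨b, hb, hbi⟩ := hb
    have h1 := card_components_le_of_cross hG hX ha haj hb hbi
    have h2 := ncard_add_ncard_le_of_cross hv hX
    exact Or.inr (Or.inr ⟨by omega,
      ncard_lt_of_mem (hne a ha) ((hX a ha).resolve_right haj) (fun q => haj q.2) fun u q => q.1,
      ncard_lt_of_mem (hne b hb) ((hX b hb).resolve_left hbi) (fun q => hbi q.1) fun u q => q.2⟩)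
  constructor
  · by_cases hX : ∃ i j, ∀ u ∈ X, ρ u = i ∨ κ u = j
    · obtain ⟨i, j, hX⟩ := hX
      rcases hcross i j hX with hi | hj | ⟨h1, h2, h3⟩
      · have := hrow i hi; have := h.row i; omega
      · have := hcol j hj; have := h.col j; omega
      · have := h.cross i j h2 h3; omega
    · push Not at hX
      have hcard : X.ncard + 1 ≤ Nat.card V := by
        rw [← Set.ncard_insert_of_notMem hv, ← Set.ncard_univ]
        exact Set.ncard_le_ncard (Set.subset_univ _)
      rcases card_components_le_one_or_isGrid hG hX with h1 | h1
      · omega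
      · have h2 := h1.card_components_le_two hG
        -- Two components are affordable as soon as `X` misses a vertex besides `v`; the balance
        -- condition excludes the only other grid, `X = V ∖ {v}`.
        have hlt : X.ncard < {u | u ≠ v}.ncard := by
          refine Set.ncard_lt_ncard ⟨hne, fun hs => h.grid ?_⟩ (Set.toFinite _)
          rwa [← Set.Subset.antisymm hne hs]
        have h3 := Set.ncard_add_ncard_compl {v}
        rw [Set.ncard_singleton] at h3
        have : ({v}ᶜ : Set V) = {u | u ≠ v} := rfl
        rw [this] at h3
        omega
  · intro hn
    have hX : ∀ u ∈ X, ρ u = ρ v ∨ κ u = κ v := by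
      intro u hu
      have := hn u hu
      rw [hG] at this
      by_contra! hc
      exact this ⟨hc.1.symm, hc.2.symm⟩
    rcases hcross _ _ hX with hi | hj | ⟨h1, h2, h3⟩
    · have := hrow _ hi; have := h.row_self; omega
    · have := hcol _ hj; have := h.col_self; omega
    · have := h.cross_self h2 h3; omega

theorem ncard_le_card_components_of_eq [Finite V]
    (hG : ∀ u w, G.Adj u w ↔ ρ u ≠ ρ w ∧ κ u ≠ κ w) {X : Set V}
    (hX : ∀ u ∈ X, ∀ w ∈ X, ρ u = ρ w ∨ κ u = κ w) :
    X.ncard ≤ Nat.card (G.induce X).ConnectedComponent := by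
  have := ncard_image_le_card_components G X id fun u hu w hw hadj =>
    absurd ((hG u w).1 hadj) fun h => (hX u hu w hw).elim h.1 h.2
  rwa [Set.image_id] at this

/-- Crossing vertices are isolated inside the cross, so the map that fixes them and sends the rest
to `none` is constant along edges. The hypothesis supplies a vertex with value `none`. -/
theorem le_card_components_of_cross [Finite V]
    (hG : ∀ u w, G.Adj u w ↔ ρ u ≠ ρ w ∧ κ u ≠ κ w) {v : V} {i : α} {j : β}
    (h : {u | u ≠ v ∧ ρ u = i ∧ κ u = j}.ncard < {u | u ≠ v ∧ ρ u = i}.ncard) :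
    {u | u ≠ v ∧ ρ u = i ∧ κ u = j}.ncard + 1 ≤
      Nat.card (G.induce {u | u ≠ v ∧ (ρ u = i ∨ κ u = j)}).ConnectedComponent := by
  classical
  obtain ⟨a, ha, ha'⟩ := Set.exists_mem_notMem_of_ncard_lt_ncard h
  refine le_trans ?_ (ncard_image_le_card_components G _
    (fun u => if ρ u = i ∧ κ u = j then some u else none) ?_)
  · have : insert none (some '' {u | u ≠ v ∧ ρ u = i ∧ κ u = j}) ⊆
        (fun u => if ρ u = i ∧ κ u = j then some u else none) ''
          {u | u ≠ v ∧ (ρ u = i ∨ κ u = j)} := by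
      rintro _ (rfl | ⟨u, hu, rfl⟩)
      · exact ⟨a, ⟨ha.1, Or.inl ha.2⟩, if_neg fun q => ha' ⟨ha.1, q⟩⟩
      · exact ⟨u, ⟨hu.1, Or.inl hu.2.1⟩, if_pos hu.2⟩
    refine le_trans ?_ (Set.ncard_le_ncard this (Set.toFinite _))
    rw [Set.ncard_insert_of_notMem (by simp), Set.ncard_image_of_injective _ (Option.some_injective V)]
  · rintro u ⟨-, hu⟩ w ⟨-, hw⟩ hadj
    rw [hG] at hadj
    have h1 : ¬ (ρ u = i ∧ κ u = j) := by grind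
    have h2 : ¬ (ρ w = i ∧ κ w = j) := by grind
    simp only [h1, h2, if_false]

/-- Necessity tests toughness on full rows, full columns, full crosses and all of `V ∖ {v}`. A cross
with parts r, c and intersection x has r + c − x vertices and at least x + 1 components, whence the
bound r + c + 1. The `self` versions have no neighbour of `v` and are stricter by one. -/
theorem isToughVertex_iff_isBalanced [Finite V]
    (hG : ∀ u w, G.Adj u w ↔ ρ u ≠ ρ w ∧ κ u ≠ κ w) (v : V) :
    IsToughVertex G v ↔ IsBalanced ρ κ v := by
  refine ⟨fun h => ?_, IsBalanced.isToughVertex hG⟩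
  rw [isToughVertex_iff] at h
  have hrow : ∀ i, {u | u ≠ v ∧ ρ u = i}.ncard ≤
      Nat.card (G.induce {u | u ≠ v ∧ ρ u = i}).ConnectedComponent := fun i =>
    ncard_le_card_components_of_eq hG fun u hu w hw => Or.inl (hu.2.trans hw.2.symm)
  have hcol : ∀ j, {u | u ≠ v ∧ κ u = j}.ncard ≤
      Nat.card (G.induce {u | u ≠ v ∧ κ u = j}).ConnectedComponent := fun j =>
    ncard_le_card_components_of_eq hG fun u hu w hw => Or.inr (hu.2.trans hw.2.symm)
  constructor
  · intro i
    have h1 := (h {u | u ≠ v ∧ ρ u = i} (by simp)).1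
    have := hrow i; omega
  · have h1 := (h {u | u ≠ v ∧ ρ u = ρ v} (by simp)).2
      fun u hu ha => ((hG v u).1 ha).1 hu.2.symm
    have := hrow (ρ v); omega
  · intro j
    have h1 := (h {u | u ≠ v ∧ κ u = j} (by simp)).1
    have := hcol j; omega
  · have h1 := (h {u | u ≠ v ∧ κ u = κ v} (by simp)).2
      fun u hu ha => ((hG v u).1 ha).2 hu.2.symm
    have := hcol (κ v); omega
  · intro i j hr hc
    have h1 := (h {u | u ≠ v ∧ (ρ u = i ∨ κ u = j)} (by simp)).1
    have h2 := le_card_components_of_cross hG hr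
    have h3 := ncard_cross (ρ := ρ) (κ := κ) v i j
    omega
  · intro hr hc
    have h1 := (h {u | u ≠ v ∧ (ρ u = ρ v ∨ κ u = κ v)} (by simp)).2
      fun u hu ha => hu.2.elim (fun e => ((hG v u).1 ha).1 e.symm) fun e => ((hG v u).1 ha).2 e.symm
    have h2 := le_card_components_of_cross hG hr
    have h3 := ncard_cross (ρ := ρ) (κ := κ) v (ρ v) (κ v)
    omega
  · intro hg
    have h1 := (h {u | u ≠ v} (by simp)).1
    have h2 := hg.two_le_card_components hG
    have h3 := Set.ncard_add_ncard_compl {v}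
    rw [Set.ncard_singleton, show ({v}ᶜ : Set V) = {u | u ≠ v} from rfl] at h3
    omega

end Balanced

/-! ### The counters of the algorithm -/

section Counters

theorem ind_of_pos {P : Prop} [Decidable P] (h : P) : ind P = 1 := if_pos h

theorem ind_of_not {P : Prop} [Decidable P] (h : ¬ P) : ind P = 0 := if_neg h

theorem ind_eq_zero {P : Prop} [Decidable P] : ind P = 0 ↔ ¬ P := by
  unfold ind; split_ifs <;> simp_all

theorem sum_eq_single_value_iff {ι : Type*} [Fintype ι] [DecidableEq ι] (f : ι → ℕ) (a : ι) :
    ∑ i, f i = f a ↔ ∀ i, i ≠ a → f i = 0 := by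
  rw [← Finset.add_sum_erase _ _ (Finset.mem_univ a), add_eq_left, Finset.sum_eq_zero_iff]
  simp

/-- Inclusion–exclusion: it lets one global counter, one row counter and one column counter decide
whether a bad pair avoids both the row and the column of the candidate. -/
theorem sum_add_eq_cross_iff {ι κ : Type*} [Fintype ι] [Fintype κ] [DecidableEq ι] [DecidableEq κ]
    (f : ι → κ → ℕ) (a : ι) (b : κ) :
    ∑ i, ∑ j, f i j + f a b = ∑ j, f a j + ∑ i, f i b ↔
      ∀ i, i ≠ a → ∀ j, j ≠ b → f i j = 0 := by
  have h1 := Finset.add_sum_erase Finset.univ (fun i => ∑ j, f i j) (Finset.mem_univ a)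
  have h2 := Finset.add_sum_erase Finset.univ (fun i => f i b) (Finset.mem_univ a)
  have h3 : ∑ i ∈ Finset.univ.erase a, ∑ j, f i j = ∑ i ∈ Finset.univ.erase a, f i b +
      ∑ i ∈ Finset.univ.erase a, ∑ j ∈ Finset.univ.erase b, f i j := by
    rw [← Finset.sum_add_distrib]
    exact Finset.sum_congr rfl fun i _ => (Finset.add_sum_erase _ _ (Finset.mem_univ b)).symm
  have h4 : ∑ i ∈ Finset.univ.erase a, ∑ j ∈ Finset.univ.erase b, f i j = 0 ↔
      ∀ i, i ≠ a → ∀ j, j ≠ b → f i j = 0 := by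
    simp [Finset.sum_eq_zero_iff]
  rw [← h4]
  omega

/-- The number of used indices before and after the deletion of a vertex with index `a`. -/
theorem sum_ind_pos_add {ι : Type*} [Fintype ι] [DecidableEq ι] (f g : ι → ℕ) (a : ι)
    (h : ∀ i, g i + ind (i = a) = f i) :
    ∑ i, ind (0 < g i) + ind (f a = 1) = ∑ i, ind (0 < f i) := by
  rw [← Finset.add_sum_erase _ _ (Finset.mem_univ a),
    ← Finset.add_sum_erase _ (fun i => ind (0 < f i)) (Finset.mem_univ a)]
  have h1 : ∀ i ∈ Finset.univ.erase a, ind (0 < g i) = ind (0 < f i) := fun i hi => by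
    rw [← h i, ind_of_not (Finset.ne_of_mem_erase hi), add_zero]
  rw [Finset.sum_congr rfl h1]
  have h2 := h a
  rw [ind_of_pos rfl] at h2
  unfold ind
  split_ifs <;> omega

theorem ncard_image_eq_sum_ind {V α : Type*} [Finite V] [Fintype α] (f : V → α) (X : Set V) :
    (f '' X).ncard = ∑ i, ind (0 < {u | u ∈ X ∧ f u = i}.ncard) := by
  classical
  have : f '' X = ((Finset.univ.filter fun i => 0 < {u | u ∈ X ∧ f u = i}.ncard : Finset α) :
      Set α) := by
    ext i
    simp [Set.ncard_pos (Set.toFinite _), Set.Nonempty]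
  rw [this, Set.ncard_coe_finset, Finset.card_filter]
  rfl

/-- Four used boxes inside a product of two rows and two columns must fill it, so three counts
recognise a grid. -/
theorem isGrid_iff_ncard {V α β : Type*} [Finite α] [Finite β] (ρ : V → α) (κ : V → β) (X : Set V) :
    IsGrid ρ κ X ↔ (ρ '' X).ncard = 2 ∧ (κ '' X).ncard = 2 ∧
      ((fun u => (ρ u, κ u)) '' X).ncard = 4 := by
  constructor
  · rintro ⟨i, i', j, j', hi, hj, ⟨a, ha, ha1, ha2⟩, ⟨b, hb, hb1, hb2⟩, ⟨c, hc, hc1, hc2⟩,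
      ⟨d, hd, hd1, hd2⟩, h⟩
    have h1 : ρ '' X = {i, i'} := by
      apply Set.Subset.antisymm
      · rintro _ ⟨u, hu, rfl⟩; exact (h u hu).1
      · rintro _ (rfl | rfl)
        exacts [⟨a, ha, ha1⟩, ⟨c, hc, hc1⟩]
    have h2 : κ '' X = {j, j'} := by
      apply Set.Subset.antisymm
      · rintro _ ⟨u, hu, rfl⟩; exact (h u hu).2
      · rintro _ (rfl | rfl)
        exacts [⟨a, ha, ha2⟩, ⟨b, hb, hb2⟩]
    have h3 : (fun u => (ρ u, κ u)) '' X = ({i, i'} : Set α) ×ˢ ({j, j'} : Set β) := by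
      apply Set.Subset.antisymm
      · rintro _ ⟨u, hu, rfl⟩; exact h u hu
      · rintro ⟨k, l⟩ ⟨rfl | rfl, rfl | rfl⟩
        exacts [⟨a, ha, Prod.ext ha1 ha2⟩, ⟨b, hb, Prod.ext hb1 hb2⟩, ⟨c, hc, Prod.ext hc1 hc2⟩,
          ⟨d, hd, Prod.ext hd1 hd2⟩]
    rw [h1, h2, h3, Set.ncard_prod, Set.ncard_pair hi, Set.ncard_pair hj]
    simp
  · rintro ⟨h1, h2, h3⟩
    obtain ⟨i, i', hi, h1⟩ := Set.ncard_eq_two.1 h1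
    obtain ⟨j, j', hj, h2⟩ := Set.ncard_eq_two.1 h2
    have hmem : ∀ u ∈ X, (ρ u = i ∨ ρ u = i') ∧ (κ u = j ∨ κ u = j') := fun u hu =>
      ⟨h1.subset ⟨u, hu, rfl⟩, h2.subset ⟨u, hu, rfl⟩⟩
    have hall : (fun u => (ρ u, κ u)) '' X = ({i, i'} : Set α) ×ˢ ({j, j'} : Set β) := by
      refine Set.eq_of_subset_of_ncard_le ?_ ?_ (Set.toFinite _)
      · rintro _ ⟨u, hu, rfl⟩; exact hmem u hu
      · rw [h3, Set.ncard_prod, Set.ncard_pair hi, Set.ncard_pair hj]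
    have hex : ∀ k ∈ ({i, i'} : Set α), ∀ l ∈ ({j, j'} : Set β), ∃ u ∈ X, ρ u = k ∧ κ u = l := by
      intro k hk l hl
      obtain ⟨u, hu, he⟩ := hall.symm.subset (Set.mk_mem_prod hk hl)
      exact ⟨u, hu, congrArg Prod.fst he, congrArg Prod.snd he⟩
    exact ⟨i, i', j, j', hi, hj, hex _ (by simp) _ (by simp), hex _ (by simp) _ (by simp),
      hex _ (by simp) _ (by simp), hex _ (by simp) _ (by simp), hmem⟩

end Counters

/-! ### The test of the algorithm -/

section Test

variable {p q : ℕ} (t : Fin p → Fin q → ℕ)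

theorem mem_toughBoxes (b : Fin p × Fin q) (r : Fin p → ℕ) (c : Fin q → ℕ) (N : ℕ)
    (hr : ∀ i, ∑ j, t i j = r i) (hc : ∀ j, ∑ i, t i j = c j) (hN : ∑ i, r i = N) :
    b ∈ (toughBoxes t).val ↔
      0 < t b.1 b.2 ∧
      ∑ i, ind (N < 2 * r i) = ind (N < 2 * r b.1) ∧ 2 * r b.1 ≤ N + 1 ∧
      ∑ j, ind (N < 2 * c j) = ind (N < 2 * c b.2) ∧ 2 * c b.2 ≤ N + 1 ∧
      ∑ i, ∑ j, heavyOutside (t i j) (r i) (c j) N +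
          heavyOutside (t b.1 b.2) (r b.1) (c b.2) N =
        ∑ j, heavyOutside (t b.1 j) (r b.1) (c j) N +
          ∑ i, heavyOutside (t i b.2) (r i) (c b.2) N ∧
      ∑ j, heavyInRow (t b.1 j) (r b.1) (c j) N =
        heavyInRow (t b.1 b.2) (r b.1) (c b.2) N ∧
      ∑ i, heavyInColumn (t i b.2) (r i) (c b.2) N =
        heavyInColumn (t b.1 b.2) (r b.1) (c b.2) N ∧
      heavyInBoth (t b.1 b.2) (r b.1) (c b.2) N = 0 ∧
      ¬ (∑ i, ind (0 < r i) = 2 + ind (r b.1 = 1) ∧ ∑ j, ind (0 < c j) = 2 + ind (c b.2 = 1) ∧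
        ∑ i, ∑ j, ind (0 < t i j) = 4 + ind (t b.1 b.2 = 1)) := by
  obtain rfl : (fun i => ∑ j, t i j) = r := funext hr
  obtain rfl : (fun j => ∑ i, t i j) = c := funext hc
  subst hN
  change b ∈ List.filter _ _ ↔ _
  rw [List.mem_filter]
  have hb : b ∈ List.finRange p ×ˢ List.finRange q :=
    List.mem_product.2 ⟨List.mem_finRange _, List.mem_finRange _⟩
  simp only [hb, true_and]
  exact decide_eq_true_iff

theorem ncard_ne_and_add_ind (v : Σ b : Fin p × Fin q, Fin (t b.1 b.2))
    (P : Fin p × Fin q → Prop) [DecidablePred P] :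
    {u | u ≠ v ∧ P u.1}.ncard + ind (P v.1) = ∑ b, if P b then t b.1 b.2 else 0 := by
  classical
  have h1 : ∑ b, (if P b then t b.1 b.2 else 0) =
      {u : Σ b : Fin p × Fin q, Fin (t b.1 b.2) | P u.1}.ncard := by
    have : {u : Σ b : Fin p × Fin q, Fin (t b.1 b.2) | P u.1} =
        (((Finset.univ.filter P).sigma fun _ => Finset.univ :
          Finset (Σ b : Fin p × Fin q, Fin (t b.1 b.2))) : Set _) := by
      ext; simp
    rw [this, Set.ncard_coe_finset, Finset.card_sigma, Finset.sum_filter]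
    simp
  have h2 : {u : Σ b : Fin p × Fin q, Fin (t b.1 b.2) | u ≠ v ∧ P u.1} = {u | P u.1} \ {v} := by
    ext u; simp [and_comm]
  rw [h1, h2]
  by_cases hv : P v.1
  · rw [ind_of_pos hv]
    exact Set.ncard_sdiff_singleton_add_one hv
  · rw [ind_of_not hv, Set.sdiff_singleton_eq_self (by exact hv), add_zero]

theorem card_skewGraph_vertices :
    Nat.card (Σ b : Fin p × Fin q, Fin (t b.1 b.2)) = ∑ i, ∑ j, t i j := by
  rw [Nat.card_eq_fintype_card, Fintype.card_sigma, Fintype.sum_prod_type]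
  simp

/-- The algorithm uses counts that include `v`, while `IsBalanced` uses counts without it; they
differ by one in the row, the column and the box of `v`. This shift produces the thresholds of the
four `heavy` conditions and `2 * r ≤ N + 1`. Where a `self` inequality exists it implies the plain
one, so only the former is tested. -/
theorem mem_toughBoxes_iff_isBalanced (v : Σ b : Fin p × Fin q, Fin (t b.1 b.2)) :
    v.1 ∈ (toughBoxes t).val ↔ IsBalanced (fun u => u.1.1) (fun u => u.1.2) v := by
  have hr : ∀ i, {u | u ≠ v ∧ u.1.1 = i}.ncard + ind (i = v.1.1) = ∑ j, t i j := by
    intro i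
    have := ncard_ne_and_add_ind t v (fun b => b.1 = i)
    rw [Fintype.sum_prod_type] at this
    simpa [Finset.sum_ite_irrel, eq_comm (a := i), ind] using this
  have hc : ∀ j, {u | u ≠ v ∧ u.1.2 = j}.ncard + ind (j = v.1.2) = ∑ i, t i j := by
    intro j
    have := ncard_ne_and_add_ind t v (fun b => b.2 = j)
    rw [Fintype.sum_prod_type] at this
    simpa [eq_comm (a := j), ind] using this
  have hx : ∀ i j, {u | u ≠ v ∧ u.1.1 = i ∧ u.1.2 = j}.ncard + ind (i = v.1.1 ∧ j = v.1.2) =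
      t i j := by
    intro i j
    have := ncard_ne_and_add_ind t v (fun b => b = (i, j))
    rw [Finset.sum_ite_eq' Finset.univ (i, j)] at this
    simpa [Prod.ext_iff, eq_comm (a := i), eq_comm (a := j), ind] using this
  have hN := card_skewGraph_vertices t
  have hgrid : IsGrid (fun u => u.1.1) (fun u => u.1.2) {u | u ≠ v} ↔
      ∑ i, ind (0 < ∑ j, t i j) = 2 + ind (∑ j, t v.1.1 j = 1) ∧
      ∑ j, ind (0 < ∑ i, t i j) = 2 + ind (∑ i, t i v.1.2 = 1) ∧
      ∑ i, ∑ j, ind (0 < t i j) = 4 + ind (t v.1.1 v.1.2 = 1) := by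
    have h1 := sum_ind_pos_add (fun i => ∑ j, t i j) _ v.1.1 hr
    have h2 := sum_ind_pos_add (fun j => ∑ i, t i j) _ v.1.2 hc
    have h3 := sum_ind_pos_add (fun b : Fin p × Fin q => t b.1 b.2)
      (fun b => {u | u ≠ v ∧ u.1.1 = b.1 ∧ u.1.2 = b.2}.ncard) v.1
      (fun b => by rw [← hx b.1 b.2]; simp [ind, Prod.ext_iff])
    rw [isGrid_iff_ncard, ncard_image_eq_sum_ind, ncard_image_eq_sum_ind, ncard_image_eq_sum_ind]
    rw [Fintype.sum_prod_type (f := fun b : Fin p × Fin q => ind (0 < t b.1 b.2))] at h3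
    simp only [Set.mem_ofPred_eq, Prod.ext_iff] at h1 h2 h3 ⊢
    omega
  rw [mem_toughBoxes t v.1 _ _ _ (fun _ => rfl) (fun _ => rfl) rfl, ← hgrid,
    sum_eq_single_value_iff (fun i => ind (_ < 2 * ∑ j, t i j)),
    sum_eq_single_value_iff (fun j => ind (_ < 2 * ∑ i, t i j)),
    sum_add_eq_cross_iff (fun i j => heavyOutside (t i j) (∑ j, t i j) (∑ i, t i j) _),
    sum_eq_single_value_iff (fun j => heavyInRow (t v.1.1 j) _ (∑ i, t i j) _),
    sum_eq_single_value_iff (fun i => heavyInColumn (t i v.1.2) (∑ j, t i j) _ _), ← hN]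
  simp only [heavyOutside, heavyInRow, heavyInColumn, heavyInBoth, ind_eq_zero]
  have hr0 := hr v.1.1
  have hc0 := hc v.1.2
  have hx0 := hx v.1.1 v.1.2
  rw [ind_of_pos rfl] at hr0 hc0
  rw [ind_of_pos ⟨rfl, rfl⟩] at hx0
  have hr1 : ∀ i, i ≠ v.1.1 → {u | u ≠ v ∧ u.1.1 = i}.ncard = ∑ j, t i j := fun i hi => by
    rw [← hr, ind_of_not hi, add_zero]
  have hc1 : ∀ j, j ≠ v.1.2 → {u | u ≠ v ∧ u.1.2 = j}.ncard = ∑ i, t i j := fun j hj => by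
    rw [← hc, ind_of_not hj, add_zero]
  have hx1 : ∀ i j, ¬ (i = v.1.1 ∧ j = v.1.2) →
      {u | u ≠ v ∧ u.1.1 = i ∧ u.1.2 = j}.ncard = t i j := fun i j hij => by
    rw [← hx, ind_of_not hij, add_zero]
  constructor
  · rintro ⟨-, h1, h2, h3, h4, h5, h6, h7, h8, h9⟩
    refine ⟨fun i => ?_, by omega, fun j => ?_, by omega, fun i j => ?_, by omega, h9⟩
    · by_cases hi : i = v.1.1
      · subst hi; omega
      · have := h1 i hi; have := hr1 i hi; omega
    · by_cases hj : j = v.1.2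
      · subst hj; omega
      · have := h3 j hj; have := hc1 j hj; omega
    · by_cases hi : i = v.1.1
      · by_cases hj : j = v.1.2
        · subst hi hj; omega
        · subst hi
          have := h6 j hj; have := hc1 j hj; have := hx1 v.1.1 j (fun e => hj e.2); omega
      · by_cases hj : j = v.1.2
        · subst hj
          have := h7 i hi; have := hr1 i hi; have := hx1 i v.1.2 (fun e => hi e.1); omega
        · have := h5 i hi j hj; have := hr1 i hi; have := hc1 j hj
          have := hx1 i j (fun e => hi e.1); omega
  · rintro ⟨h1, h2, h3, h4, h5, h6, h7⟩
    refine ⟨by omega, fun i hi => ?_, by omega, fun j hj => ?_, by omega, fun i hi j hj => ?_,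
      fun j hj => ?_, fun i hi => ?_, by omega, h7⟩
    · have := h1 i; have := hr1 i hi; omega
    · have := h3 j; have := hc1 j hj; omega
    · have := h5 i j; have := hr1 i hi; have := hc1 j hj
      have := hx1 i j (fun e => hi e.1); omega
    · have := h5 v.1.1 j; have := hc1 j hj; have := hx1 v.1.1 j (fun e => hj e.2); omega
    · have := h5 i v.1.2; have := hr1 i hi; have := hx1 i v.1.2 (fun e => hi e.1); omega

theorem pos_of_mem_toughBoxes {b : Fin p × Fin q} (h : b ∈ (toughBoxes t).val) :
    0 < t b.1 b.2 :=
  ((mem_toughBoxes t b _ _ _ (fun _ => rfl) (fun _ => rfl) rfl).1 h).1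

/-- The boxes which the algorithm selects are the boxes of the tough vertices. -/
theorem mem_toughBoxes_iff (b : Fin p × Fin q) :
    b ∈ (toughBoxes t).val ↔ ∃ x : Fin (t b.1 b.2), IsToughVertex (skewGraph t) ⟨b, x⟩ := by
  -- In particular, toughness depends only on the box of the vertex.
  have key : ∀ v, IsToughVertex (skewGraph t) v ↔ v.1 ∈ (toughBoxes t).val := fun v => by
    rw [mem_toughBoxes_iff_isBalanced]
    exact isToughVertex_iff_isBalanced (G := skewGraph t) (ρ := fun u => u.1.1)
      (κ := fun u => u.1.2) (fun _ _ => Iff.rfl) v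
  constructor
  · intro h
    exact ⟨⟨0, pos_of_mem_toughBoxes t h⟩, (key _).2 h⟩
  · rintro ⟨x, hx⟩
    exact (key _).1 hx

end Test

/-! ### Rectangles and Hamiltonian paths -/

section Rectangles

/-- Two boxes in different rows and in different columns. -/
def IsSkewStep {p q : ℕ} (a b : Fin p × Fin q) : Prop := a.1 ≠ b.1 ∧ a.2 ≠ b.2

theorem rel_of_idxOf_eq_add_one {α : Type*} [BEq α] [LawfulBEq α] {R : α → α → Prop} {P : List α}
    (hP : P.IsChain R) {a b : α} (hb : b ∈ P) (h : P.idxOf b = P.idxOf a + 1) : R a b := by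
  have hlt := List.idxOf_lt_length_of_mem hb
  have := List.isChain_iff_getElem.1 hP (P.idxOf a) (by omega)
  simp only [← h, List.getElem_idxOf] at this
  exact this

theorem isLambdaRectangle_arrayOfPath {m n : ℕ} {P : List (Fin m × Fin n)}
    (hlen : P.length = m * n) (hnd : P.Nodup) (hmem : ∀ b, b ∈ P) (hP : P.IsChain IsSkewStep) :
    IsLambdaRectangle (arrayOfPath P : Fin m → Fin n → ℕ) := by
  have hdiff : ∀ a b : Fin m × Fin n, a ≠ b → ¬ IsSkewStep a b →
      2 ≤ |((arrayOfPath P a.1 a.2 : ℕ) : ℤ) - (arrayOfPath P b.1 b.2 : ℕ)| := by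
    intro a b hab hs
    have h1 : P.idxOf a ≠ P.idxOf b := fun h => hab ((List.idxOf_inj (hmem a)).1 h)
    have h2 : P.idxOf b ≠ P.idxOf a + 1 := fun h => hs (rel_of_idxOf_eq_add_one hP (hmem b) h)
    have h3 : P.idxOf a ≠ P.idxOf b + 1 := fun h =>
      hs ((rel_of_idxOf_eq_add_one hP (hmem a) h).imp Ne.symm Ne.symm)
    simp only [arrayOfPath, Prod.mk.eta, le_abs]
    omega
  refine ⟨⟨fun x _ => ?_, fun x _ y _ h => ?_, fun k hk => ?_⟩, fun i j j' h => ?_,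
    fun i i' j h => ?_⟩
  · have := List.idxOf_lt_length_of_mem (hmem x)
    simp only [arrayOfPath, Prod.mk.eta, Set.mem_Icc]
    omega
  · simp only [arrayOfPath, Prod.mk.eta, add_left_inj] at h
    exact (List.idxOf_inj (hmem x)).1 h
  · obtain ⟨h1, h2⟩ := hk
    refine ⟨P[k - 1]'(by omega), trivial, ?_⟩
    simp only [arrayOfPath, Prod.mk.eta, hnd.idxOf_getElem]
    omega
  · exact hdiff (i, j) (i, j') (by simpa using h) fun hs => hs.1 rfl
  · exact hdiff (i, j) (i', j) (by simpa using h) fun hs => hs.2 rfl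

theorem IsLambdaRectangle.exists_path {m n : ℕ} {A : Fin m → Fin n → ℕ}
    (hA : IsLambdaRectangle A) : ∃ P : List (Fin m × Fin n), P.length = m * n ∧ P.Nodup ∧
      (∀ b, b ∈ P) ∧ P.IsChain IsSkewStep ∧ arrayOfPath P = A := by
  obtain ⟨⟨hmaps, hinj, hsurj⟩, hrow, hcol⟩ := hA
  have hex : ∀ k : Fin (m * n), ∃ x : Fin m × Fin n, A x.1 x.2 = k + 1 := fun k => by
    obtain ⟨x, -, hx⟩ := hsurj (a := (k + 1 : ℕ)) ⟨by omega, by omega⟩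
    exact ⟨x, hx⟩
  choose e he using hex
  have heA : ∀ (b : Fin m × Fin n) (k : Fin (m * n)), A b.1 b.2 = k + 1 → e k = b := fun b k h =>
    hinj (Set.mem_univ _) (Set.mem_univ _) ((he k).trans h.symm)
  have hidx : ∀ b : Fin m × Fin n, ∃ k : Fin (m * n), A b.1 b.2 = k + 1 := fun b => by
    have := hmaps (Set.mem_univ b)
    simp only [Set.mem_Icc] at this
    exact ⟨⟨A b.1 b.2 - 1, by omega⟩, by simp only; omega⟩
  have hnd : (List.ofFn e).Nodup := List.nodup_ofFn.2 fun k l h => by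
    have := he k
    rw [h, he l] at this
    exact Fin.ext (by omega)
  refine ⟨List.ofFn e, List.length_ofFn, hnd, fun b => ?_, ?_, ?_⟩
  · obtain ⟨k, hk⟩ := hidx b
    exact (List.mem_ofFn' _ _).2 ⟨k, heA b k hk⟩
  · rw [List.isChain_iff_getElem]
    intro k hk
    rw [List.length_ofFn] at hk
    simp only [List.getElem_ofFn]
    have h1 := he ⟨k, by omega⟩
    have h2 := he ⟨k + 1, hk⟩
    generalize e ⟨k, by omega⟩ = a at h1
    generalize e ⟨k + 1, hk⟩ = b at h2
    simp only at h1 h2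
    constructor <;> intro h
    · have := hrow a.1 a.2 b.2 (fun h' => by rw [h, h', h2] at h1; omega)
      rw [h1, h, h2] at this
      push_cast at this
      norm_num at this
    · have := hcol a.1 b.1 a.2 (fun h' => by rw [h, h', h2] at h1; omega)
      rw [h1, h, h2] at this
      push_cast at this
      norm_num at this
  · funext i j
    obtain ⟨k, hk⟩ := hidx (i, j)
    have := hnd.idxOf_getElem k (by simp)
    rw [List.getElem_ofFn, heA (i, j) k hk] at this
    rw [arrayOfPath, this]
    exact hk.symm

/-! ### Existence of rectangles. -/

theorem IsLambdaRectangle.transpose {m n : ℕ} {A : Fin m → Fin n → ℕ}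
    (hA : IsLambdaRectangle A) : IsLambdaRectangle fun j i => A i j := by
  refine ⟨?_, fun j i i' h => hA.2.2 i i' j h, fun j j' i h => hA.2.1 i j j' h⟩
  rw [mul_comm n m]
  exact hA.1.comp (Equiv.prodComm (Fin n) (Fin m)).bijective.bijOn_univ

/-- The box number `k` of the diagonal path: after `lcm m n` steps the path moves to the next
diagonal. -/
def diagonalBox (m n k : ℕ) (hm : 0 < m) (hn : 0 < n) : Fin m × Fin n :=
  (⟨k % m, Nat.mod_lt _ hm⟩, ⟨(k + k / Nat.lcm m n) % n, Nat.mod_lt _ hn⟩)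

/-- Modulo `gcd m n` the two coordinates determine the number of the diagonal, which is less than
`gcd m n` because m n = gcd · lcm. Once the diagonals agree, k and l agree modulo m and n, hence
modulo the lcm. -/
theorem diagonalBox_inj {m n k l : ℕ} (hm : 0 < m) (hn : 0 < n) (hk : k < m * n) (hl : l < m * n)
    (h : diagonalBox m n k hm hn = diagonalBox m n l hm hn) : k = l := by
  simp only [diagonalBox, Prod.mk.injEq, Fin.mk.injEq] at h
  have h1 : k ≡ l [MOD m] := h.1
  have h2 : k + k / Nat.lcm m n ≡ l + l / Nat.lcm m n [MOD n] := h.2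
  have hL : 0 < Nat.lcm m n := Nat.lcm_pos hm hn
  have hdiv : ∀ x, x < m * n → x / Nat.lcm m n < Nat.gcd m n := fun x hx => by
    rw [Nat.div_lt_iff_lt_mul hL, Nat.gcd_mul_lcm]
    exact hx
  have h3 : k / Nat.lcm m n ≡ l / Nat.lcm m n [MOD Nat.gcd m n] :=
    Nat.ModEq.add_left_cancel (h1.of_dvd (Nat.gcd_dvd_left m n))
      (h2.of_dvd (Nat.gcd_dvd_right m n))
  have h4 := h3.eq_of_lt_of_lt (hdiv k hk) (hdiv l hl)
  rw [h4] at h2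
  have h5 : k ≡ l [MOD n] := Nat.ModEq.add_right_cancel' _ h2
  have h6 : k % Nat.lcm m n = l % Nat.lcm m n := Nat.mod_lcm h1 h5
  rw [← Nat.div_add_mod k (Nat.lcm m n), ← Nat.div_add_mod l (Nat.lcm m n), h4, h6]

theorem not_modEq_add {d k e : ℕ} (he : 0 < e) (hd : e < d) : ¬ k ≡ k + e [MOD d] := fun h => by
  have h1 : k + 0 ≡ k + e [MOD d] := h
  have h2 := (Nat.ModEq.add_left_cancel' k h1).eq_of_lt_of_lt (by omega) hd
  omega

/-- The column advances by one, or by two when the diagonal changes; the latter is what needs three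
columns. -/
theorem isSkewStep_diagonalBox {m n : ℕ} (hm : 2 ≤ m) (hn : 3 ≤ n) (k : ℕ) :
    IsSkewStep (diagonalBox m n k (by omega) (by omega))
      (diagonalBox m n (k + 1) (by omega) (by omega)) := by
  constructor
  · intro h
    exact not_modEq_add (d := m) (k := k) one_pos hm (congrArg Fin.val h)
  · intro h
    have h : k + k / Nat.lcm m n ≡ k + 1 + (k + 1) / Nat.lcm m n [MOD n] := congrArg Fin.val h
    rw [Nat.succ_div] at h
    split_ifs at h
    · exact not_modEq_add (d := n) (k := k + k / Nat.lcm m n) two_pos hn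
        (by convert h using 1; omega)
    · exact not_modEq_add (d := n) (k := k + k / Nat.lcm m n) one_pos (by omega)
        (by convert h using 1; omega)

theorem mem_of_nodup_of_length {m n : ℕ} {P : List (Fin m × Fin n)} (hnd : P.Nodup)
    (hlen : P.length = m * n) (b : Fin m × Fin n) : b ∈ P := by
  have : P.toFinset = Finset.univ := by
    rw [← Finset.card_eq_iff_eq_univ, List.toFinset_card_of_nodup hnd, hlen]
    simp
  exact List.mem_toFinset.1 (this ▸ Finset.mem_univ b)

theorem exists_isLambdaRectangle_of_three_le {m n : ℕ} (hm : 2 ≤ m) (hn : 3 ≤ n) :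
    ∃ A : Fin m → Fin n → ℕ, IsLambdaRectangle A := by
  have hm0 : 0 < m := by omega
  have hn0 : 0 < n := by omega
  have hlen : ((List.range (m * n)).map fun k => diagonalBox m n k hm0 hn0).length = m * n := by
    simp
  have hnd : ((List.range (m * n)).map fun k => diagonalBox m n k hm0 hn0).Nodup :=
    List.Nodup.map_on (fun k hk l hl h => diagonalBox_inj hm0 hn0 (List.mem_range.1 hk)
      (List.mem_range.1 hl) h) List.nodup_range
  refine ⟨_, isLambdaRectangle_arrayOfPath hlen hnd (mem_of_nodup_of_length hnd hlen) ?_⟩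
  rw [List.isChain_iff_getElem]
  intro k hk
  simp only [List.getElem_map, List.getElem_range]
  exact isSkewStep_diagonalBox hm hn k

theorem exists_isLambdaRectangle {m n : ℕ} (hm : 2 ≤ m) (hn : 2 ≤ n) (h : ¬ (m = 2 ∧ n = 2)) :
    ∃ A : Fin m → Fin n → ℕ, IsLambdaRectangle A := by
  by_cases hn3 : 3 ≤ n
  · exact exists_isLambdaRectangle_of_three_le hm hn3
  · obtain ⟨A, hA⟩ := exists_isLambdaRectangle_of_three_le (m := n) (n := m) hn (by omega)
    exact ⟨_, hA.transpose⟩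

/-! ### Rectangles as `L(2,1)`-colorings. -/

theorem dist_boxProd_top_eq_two_iff {m n : ℕ} (u v : Fin m × Fin n) :
    (SimpleGraph.boxProd (⊤ : SimpleGraph (Fin m)) (⊤ : SimpleGraph (Fin n))).dist u v = 2 ↔
      IsSkewStep u v := by
  unfold SimpleGraph.dist IsSkewStep
  rw [SimpleGraph.edist_boxProd, SimpleGraph.edist_top, SimpleGraph.edist_top]
  by_cases h1 : u.1 = v.1 <;> by_cases h2 : u.2 = v.2 <;> simp [h1, h2]
  rfl

/-- Distinct boxes are either adjacent or at distance two, so a coloring is injective; with mn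
available labels it is then bijective. -/
theorem isLambdaRectangle_iff_isL21Coloring {m n : ℕ} (A : Fin m → Fin n → ℕ) :
    IsLambdaRectangle A ↔
      (IsL21Coloring (SimpleGraph.boxProd (⊤ : SimpleGraph (Fin m)) (⊤ : SimpleGraph (Fin n)))
        (fun x => A x.1 x.2) ∧ ∀ i j, A i j ∈ Set.Icc 1 (m * n)) := by
  simp only [IsL21Coloring, dist_boxProd_top_eq_two_iff]
  constructor
  · rintro ⟨⟨hmaps, hinj, -⟩, hrow, hcol⟩
    refine ⟨⟨fun u v huv => ?_, fun u v huv h => ?_⟩, fun i j => hmaps (Set.mem_univ (i, j))⟩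
    · rw [SimpleGraph.boxProd_adj] at huv
      rcases huv with ⟨h1, h2⟩ | ⟨h1, h2⟩
      · rw [h2]; exact hcol _ _ _ h1
      · rw [h2]; exact hrow _ _ _ h1
    · exact huv.1 (congrArg Prod.fst (hinj (Set.mem_univ u) (Set.mem_univ v) h))
  · rintro ⟨⟨hadj, hdist⟩, hmem⟩
    have hrow : ∀ i j j', j ≠ j' → 2 ≤ |(A i j : ℤ) - (A i j' : ℤ)| := fun i j j' h =>
      hadj (i, j) (i, j') (by simp [SimpleGraph.boxProd_adj, h])
    have hcol : ∀ i i' j, i ≠ i' → 2 ≤ |(A i j : ℤ) - (A i' j : ℤ)| := fun i i' j h =>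
      hadj (i, j) (i', j) (by simp [SimpleGraph.boxProd_adj, h])
    have hinj : Function.Injective fun x : Fin m × Fin n => A x.1 x.2 := by
      rintro ⟨i, j⟩ ⟨i', j'⟩ h
      simp only at h
      by_contra hne
      by_cases h1 : i = i'
      · subst h1
        have := hrow i j j' (fun e => hne (by rw [e]))
        rw [h, sub_self] at this
        norm_num at this
      · by_cases h2 : j = j'
        · subst h2
          have := hcol i i' j h1
          rw [h, sub_self] at this
          norm_num at this
        · exact hdist (i, j) (i', j') ⟨h1, h2⟩ h
    refine ⟨⟨fun x _ => hmem _ _, hinj.injOn, ?_⟩, hrow, hcol⟩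
    have himg : (fun x : Fin m × Fin n => A x.1 x.2) '' Set.univ = Set.Icc 1 (m * n) := by
      refine Set.eq_of_subset_of_ncard_le ?_ ?_ (Set.finite_Icc _ _)
      · rintro _ ⟨x, -, rfl⟩; exact hmem _ _
      · rw [Set.ncard_image_of_injective _ hinj, Set.ncard_univ, ← Finset.coe_Icc,
          Set.ncard_coe_finset]
        simp
    exact himg.symm.subset

end Rectangles

/-! ### The runs of the algorithm -/

section Runs

variable {p q : ℕ}

theorem mem_stage {t : Fin p → Fin q → ℕ} {v w : Fin p × Fin q} :
    w ∈ (stage t v).val.2 ↔ w ∈ (toughBoxes (deleteVertex t v).val).val ∧ IsSkewStep w v := by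
  change w ∈ List.filter _ _ ↔ _
  rw [List.mem_filter, decide_eq_true_iff]
  rfl

theorem stage_table (t : Fin p → Fin q → ℕ) (v b : Fin p × Fin q) :
    (stage t v).val.1 b.1 b.2 = if b = v then t b.1 b.2 - 1 else t b.1 b.2 := rfl

/-- A run is a path which visits no box more often than there are vertices in it. -/
theorem isChain_of_mem_runsFrom (k : ℕ) : ∀ (t : Fin p → Fin q → ℕ) (v : Fin p × Fin q),
    0 < t v.1 v.2 → ∀ ρ ∈ runsFrom k t v,
      ∃ Q, ρ.1 = v :: Q ∧ ρ.1.IsChain IsSkewStep ∧ ∀ b, ρ.1.count b ≤ t b.1 b.2 := by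
  have hsingle : ∀ (t : Fin p → Fin q → ℕ) (v : Fin p × Fin q), 0 < t v.1 v.2 →
      ∀ b, [v].count b ≤ t b.1 b.2 := by
    intro t v hv b
    rw [List.count_singleton]
    split_ifs with h
    · rw [beq_iff_eq] at h; subst h; exact hv
    · exact Nat.zero_le _
  induction k with
  | zero =>
    intro t v hv ρ hρ
    simp only [runsFrom, List.mem_singleton] at hρ
    subst hρ
    exact ⟨[], rfl, List.isChain_singleton _, hsingle t v hv⟩
  | succ k ih =>
    intro t v hv ρ hρ
    rw [runsFrom] at hρ
    split_ifs at hρ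
    · simp only [List.mem_singleton] at hρ
      subst hρ
      exact ⟨[], rfl, List.isChain_singleton _, hsingle t v hv⟩
    · simp only [List.mem_flatMap, List.mem_map] at hρ
      obtain ⟨w, hw, σ, hσ, rfl⟩ := hρ
      rw [mem_stage] at hw
      obtain ⟨Q, hQ, hchain, hcount⟩ := ih _ w (pos_of_mem_toughBoxes _ hw.1) σ hσ
      refine ⟨σ.1, rfl, ?_, fun b => ?_⟩
      · simp only [hQ] at hchain ⊢
        exact List.isChain_cons_cons.2 ⟨hw.2.imp Ne.symm Ne.symm, hchain⟩
      -- At `b = v` the extra visit is paid for by the deleted vertex; `hv` makes the truncated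
      -- subtraction exact.
      · have := (hcount b).trans_eq (stage_table t v b)
        simp only [List.count_cons, beq_iff_eq]
        by_cases hb : b = v
        · subst hb; simp only [if_true] at this ⊢; omega
        · simpa [hb, Ne.symm hb] using this

/-- The first box of a path which visits every vertex is selected. -/
theorem mem_toughBoxes_of_path {t : Fin p → Fin q → ℕ} {v : Fin p × Fin q}
    {Q : List (Fin p × Fin q)} (hchain : (v :: Q).IsChain IsSkewStep) (hnd : (v :: Q).Nodup)
    (ht : ∀ b, t b.1 b.2 = if b ∈ v :: Q then 1 else 0) : v ∈ (toughBoxes t).val := by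
  rw [mem_toughBoxes_iff]
  have hone : ∀ b, b ∈ v :: Q → t b.1 b.2 = 1 := fun b hb => by rw [ht, if_pos hb]
  have hmem : ∀ u : Σ b : Fin p × Fin q, Fin (t b.1 b.2), u.1 ∈ v :: Q := by
    intro u
    by_contra h
    have h0 := ht u.1
    rw [if_neg h] at h0
    exact absurd u.2.isLt (by omega)
  have hext : ∀ u w : Σ b : Fin p × Fin q, Fin (t b.1 b.2), u.1 = w.1 → u = w := by
    rintro ⟨b, x⟩ ⟨c, y⟩ h
    obtain rfl : b = c := h
    have := hone b (hmem ⟨b, x⟩)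
    exact congrArg _ (Fin.ext (by omega))
  have hv : 0 < t v.1 v.2 := by rw [hone v List.mem_cons_self]; exact one_pos
  refine ⟨⟨0, hv⟩, isToughVertex_of_positions _ _ (fun u => (v :: Q).idxOf u.1)
    (fun u w h => hext u w ((List.idxOf_inj (hmem u)).1 h)) fun u hu => ?_⟩
  have hne : u.1 ≠ v := fun h => hu (hext _ _ h)
  have hidx : (v :: Q).idxOf u.1 ≠ 0 := by
    rw [List.idxOf_cons_ne _ hne.symm]
    exact Nat.succ_ne_zero _
  have hlt := List.idxOf_lt_length_of_mem (hmem u)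
  have hw : (v :: Q).idxOf u.1 - 1 < (v :: Q).length := by omega
  have hwpos : 0 < t ((v :: Q)[(v :: Q).idxOf u.1 - 1]).1 ((v :: Q)[(v :: Q).idxOf u.1 - 1]).2 := by
    rw [hone _ (List.getElem_mem hw)]; exact one_pos
  have hi : (v :: Q).idxOf u.1 = (v :: Q).idxOf ((v :: Q)[(v :: Q).idxOf u.1 - 1]) + 1 := by
    rw [hnd.idxOf_getElem]
    omega
  exact ⟨⟨_, ⟨0, hwpos⟩⟩, rel_of_idxOf_eq_add_one hchain (hmem u) hi, hi.symm⟩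

/-- Completeness of the search. The invariant is that the table is the indicator of the boxes still
on the path, so the next box starts a Hamiltonian path of the remaining graph and is a candidate. -/
theorem mem_runsFrom_of_path (Q : List (Fin p × Fin q)) :
    ∀ (t : Fin p → Fin q → ℕ) (v : Fin p × Fin q), (v :: Q).IsChain IsSkewStep →
      (v :: Q).Nodup → (∀ b, t b.1 b.2 = if b ∈ v :: Q then 1 else 0) →
      ∃ s, (v :: Q, s) ∈ runsFrom Q.length t v := by
  induction Q with
  | nil =>
    intro t v _ _ _
    exact ⟨3, by simp [runsFrom]⟩
  | cons w Q ih =>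
    intro t v hchain hnd ht
    obtain ⟨hvw, hchain'⟩ := List.isChain_cons_cons.1 hchain
    obtain ⟨hv, hnd'⟩ := List.nodup_cons.1 hnd
    have ht' : ∀ b, (stage t v).val.1 b.1 b.2 = if b ∈ w :: Q then 1 else 0 := by
      intro b
      rw [stage_table, ht]
      by_cases hb : b = v
      · subst hb; simp only [if_true, List.mem_cons_self, hv, if_false]
      · rw [if_neg hb]
        simp only [List.mem_cons (b := v), hb, false_or]
    have hw : w ∈ (stage t v).val.2 :=
      mem_stage.2 ⟨mem_toughBoxes_of_path hchain' hnd' ht', hvw.imp Ne.symm Ne.symm⟩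
    obtain ⟨s, hs⟩ := ih _ w hchain' hnd' ht'
    refine ⟨(stage t v).steps + 3 + s, ?_⟩
    rw [List.length_cons, runsFrom, if_neg (List.ne_nil_of_mem hw)]
    exact List.mem_flatMap.2 ⟨w, hw, List.mem_map.2 ⟨_, hs, rfl⟩⟩

theorem sumLoop_onesTable (m n : ℕ) :
    (sumLoop fun i => sumLoop fun j => charge 1 (onesTable m n i j)).val = m * n := by
  simp [sumLoop, charge, onesTable]

theorem mem_generatedPaths {m n : ℕ} (hm : 0 < m) (hn : 0 < n) {P : List (Fin m × Fin n)} :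
    P ∈ generatedPaths m n ↔ P.length = m * n ∧ P.Nodup ∧ P.IsChain IsSkewStep := by
  simp only [generatedPaths, List.mem_map, List.mem_filter, decide_eq_true_iff, runs,
    List.mem_flatMap, sumLoop_onesTable]
  constructor
  · rintro ⟨_, ⟨⟨v, hv, ρ, hρ, rfl⟩, hlen⟩, rfl⟩
    obtain ⟨-, -, hchain, hcount⟩ :=
      isChain_of_mem_runsFrom _ _ v (pos_of_mem_toughBoxes _ hv) ρ hρ
    exact ⟨hlen, List.nodup_iff_count_le_one.2 hcount, hchain⟩
  · rintro ⟨hlen, hnd, hchain⟩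
    have hmem := mem_of_nodup_of_length hnd hlen
    cases P with
    | nil => have := Nat.mul_pos hm hn; simp at hlen; omega
    | cons v Q =>
      have ht : ∀ b : Fin m × Fin n, onesTable m n b.1 b.2 = if b ∈ v :: Q then 1 else 0 :=
        fun b => by rw [if_pos (hmem b)]; rfl
      obtain ⟨s, hs⟩ := mem_runsFrom_of_path Q _ v hchain hnd ht
      have hQ : m * n - 1 = Q.length := by rw [← hlen]; rfl
      refine ⟨_, ⟨⟨v, mem_toughBoxes_of_path hchain hnd ht, _, hQ ▸ hs, rfl⟩, hlen⟩, rfl⟩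

theorem setOf_isLambdaRectangle {m n : ℕ} (hm : 0 < m) (hn : 0 < n) :
    {A : Fin m → Fin n → ℕ | IsLambdaRectangle A} =
      {A | ∃ P ∈ generatedPaths m n, arrayOfPath P = A} := by
  ext A
  constructor
  · intro hA
    obtain ⟨P, hlen, hnd, -, hchain, he⟩ := IsLambdaRectangle.exists_path hA
    exact ⟨P, (mem_generatedPaths hm hn).2 ⟨hlen, hnd, hchain⟩, he⟩
  · rintro ⟨P, hP, rfl⟩
    obtain ⟨hlen, hnd, hchain⟩ := (mem_generatedPaths hm hn).1 hP
    exact isLambdaRectangle_arrayOfPath hlen hnd (mem_of_nodup_of_length hnd hlen) hchain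

/-! ### The number of steps -/

theorem Timed.steps_bind {α β : Type} (x : Timed α) (f : α → Timed β) :
    (x >>= f).steps = x.steps + (f x.val).steps := rfl

/-- No charge depends on the values in the table, so the cost is a fixed polynomial with terms in
pq, p, q and 1, all bounded by multiples of pq. The constant is not optimised. -/
theorem steps_toughBoxes_le (hp : 0 < p) (hq : 0 < q) (t : Fin p → Fin q → ℕ) :
    (toughBoxes t).steps ≤ 1000 * (p * q) := by
  simp only [toughBoxes, Timed.steps_bind, arrayLoop, sumLoop, selectLoop, charge,
    Finset.sum_const, Finset.card_univ, Fintype.card_fin, smul_eq_mul]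
  have h1 : p ≤ p * q := Nat.le_mul_of_pos_right p hq
  have h2 : q ≤ p * q := Nat.le_mul_of_pos_left q hp
  have h3 : q * p = p * q := mul_comm q p
  ring_nf
  omega

theorem length_toughBoxes_le (t : Fin p → Fin q → ℕ) : (toughBoxes t).val.length ≤ p * q := by
  refine (List.length_filter_le _ _).trans ?_
  rw [List.length_product, List.length_finRange, List.length_finRange]

theorem steps_stage_le (hp : 0 < p) (hq : 0 < q) (t : Fin p → Fin q → ℕ) (v : Fin p × Fin q) :
    (stage t v).steps + 3 ≤ 1016 * (p * q) := by
  have h1 := steps_toughBoxes_le hp hq (deleteVertex t v).val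
  have h2 := length_toughBoxes_le (deleteVertex t v).val
  have h3 := Nat.mul_pos hp hq
  -- With the final 3 this is at most 1000pq + 6pq + 10, whence the constant 1016.
  have h4 : (stage t v).steps = 6 + ((toughBoxes (deleteVertex t v).val).steps +
    (1 + 6 * (toughBoxes (deleteVertex t v).val).val.length + 0)) := rfl
  omega

theorem steps_le_of_mem_runsFrom (hp : 0 < p) (hq : 0 < q) (k : ℕ) :
    ∀ (t : Fin p → Fin q → ℕ) (v : Fin p × Fin q), ∀ ρ ∈ runsFrom k t v,
      ρ.2 ≤ (k + 1) * (1016 * (p * q)) := by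
  have hpq := Nat.mul_pos hp hq
  induction k with
  | zero =>
    intro t v ρ hρ
    simp only [runsFrom, List.mem_singleton] at hρ
    subst hρ
    simp only
    omega
  | succ k ih =>
    intro t v ρ hρ
    have h1 := steps_stage_le hp hq t v
    rw [runsFrom] at hρ
    rw [add_mul _ 1, one_mul]
    split_ifs at hρ
    · simp only [List.mem_singleton] at hρ
      subst hρ
      exact h1.trans (Nat.le_add_left _ _)
    · simp only [List.mem_flatMap, List.mem_map] at hρ
      obtain ⟨w, -, σ, hσ, rfl⟩ := hρ
      have := ih _ w σ hσ
      simp only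
      omega

theorem steps_le_of_mem_runs {m n : ℕ} (hm : 0 < m) (hn : 0 < n) :
    ∀ ρ ∈ runs (onesTable m n), ρ.2 ≤ 3000 * (m * n * (m * n)) := by
  intro ρ hρ
  simp only [runs, List.mem_flatMap, List.mem_map, sumLoop_onesTable] at hρ
  obtain ⟨v, -, σ, hσ, rfl⟩ := hρ
  have h1 := steps_le_of_mem_runsFrom hm hn _ _ v σ hσ
  have h2 := steps_toughBoxes_le hm hn (onesTable m n)
  have h3 : (sumLoop fun i => sumLoop fun j => charge 1 (onesTable m n i j)).steps ≤
      7 * (m * n) := by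
    simp only [sumLoop, charge, Finset.sum_const, Finset.card_univ, Fintype.card_fin, smul_eq_mul]
    have h4 : m ≤ m * n := Nat.le_mul_of_pos_right m hn
    have h5 := Nat.mul_pos hm hn
    ring_nf
    omega
  have hN := Nat.mul_pos hm hn
  rw [Nat.sub_add_cancel hN] at h1
  have h6 : m * n ≤ m * n * (m * n) := Nat.le_mul_of_pos_right _ hN
  have h7 : m * n * (1016 * (m * n)) = 1016 * (m * n * (m * n)) := by ring
  simp only
  omega

end Runs

theorem mainTheorem10 :
    -- existence
    (∀ m n : ℕ, 2 ≤ m → 2 ≤ n → ¬ (m = 2 ∧ n = 2) →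
      ∃ A : Fin m → Fin n → ℕ, IsLambdaRectangle A) ∧
    -- the equivalent form in terms of colorings with the labels `1, …, m * n`
    (∀ (m n : ℕ) (A : Fin m → Fin n → ℕ),
      IsLambdaRectangle A ↔
        (IsL21Coloring (SimpleGraph.boxProd (⊤ : SimpleGraph (Fin m)) (⊤ : SimpleGraph (Fin n)))
          (fun x => A x.1 x.2) ∧ ∀ i j, A i j ∈ Set.Icc 1 (m * n))) ∧
    -- the candidates of the algorithm are exactly the tough vertices
    (∀ (p q : ℕ) (t : Fin p → Fin q → ℕ) (b : Fin p × Fin q),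
      b ∈ (toughBoxes t).val ↔
        ∃ x : Fin (t b.1 b.2), IsToughVertex (skewGraph t) ⟨b, x⟩) ∧
    -- the algorithm generates all the rectangles, and nothing else
    (∀ m n : ℕ, 0 < m → 0 < n →
      {A : Fin m → Fin n → ℕ | IsLambdaRectangle A} =
        {A | ∃ P ∈ generatedPaths m n, arrayOfPath P = A}) ∧
    -- each run takes a number of steps bounded by a constant times rows × columns × vertices
    (∃ C : ℕ, ∀ m n : ℕ, 0 < m → 0 < n →
      ∀ ρ ∈ runs (onesTable m n), ρ.2 ≤ C * (m * n * (m * n))) :=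
  ⟨fun _ _ hm hn h => exists_isLambdaRectangle hm hn h,
    fun _ _ A => isLambdaRectangle_iff_isL21Coloring A,
    fun _ _ t b => mem_toughBoxes_iff t b,
    fun _ _ hm hn => setOf_isLambdaRectangle hm hn,
    3000, fun _ _ hm hn => steps_le_of_mem_runs hm hn⟩
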